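/- **Setting.** Let $X\subset\mathbb R^N$ be a Borel set, $\mu$ a Borel probability measure on $X$ and $T\colon X\to X$ a locally Lipschitz map (every point of $X$ has a neighbourhood in $X$ on which $T$ is Lipschitz). For $h\colon X\to\mathbb R$ and $k\in\mathbb N$ let $\phi=\phi_{h,k}\colon X\to\mathbb R^k$, $\phi(x)=(h(x),h(Tx),\dots,h(T^{k-1}x))$, be the $k$-delay coordinate map. The observable $h$ is *almost surely deterministically $k$-predictable* with respect to $\mu$ if there is a Borel set $X_h\subset X$ of full $\mu$-measure such that for all $x_1,x_2\in X_h$, $\phi(x_1)=\phi(x_2)$ implies $\phi(Tx_1)=\phi(Tx_2)$. A map $S$ on $\phi(X_h)$ with $S(\phi(x))=\phi(Tx)$ for all $x\in X_h$ is called a *prediction map*. The measure $\mu$ is *$T$-invariant* if $\mu(T^{-1}(E))=\mu(E)$ for every Borel set $E\subset X$. Let $\dim_H\mu$ be the infimum of the Hausdorff dimensions $\dim_H A$ over Borel sets $A\subset\mathbb R^N$ of full $\mu$-measure, and $\operatorname{supp}\mu$ the smallest closed subset of $X$ of full $\mu$-measure. Let $\mathrm{Lip}_{loc}(X)$ be the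 linear space of locally Lipschitz functions $X\to\mathbb R$. Fix a countable basis $U_1,U_2,\dots$ of the topology of $\mathbb R^N$ consisting of bounded sets, and equip $\mathrm{Lip}_{loc}(X)$ with the metric $$d(f,g)=\sum_{n=1}^\infty 2^{-n}\min\{1,\|f-g\|_{U_n\cap X}\},\qquad \|h\|_{A}=\sup_{x\in A}|h(x)|+\sup_{x,y\in A,\ x\ne y}\frac{|h(x)-h(y)|}{\|x-y\|}\in[0,\infty].$$ A Borel set $\mathcal S\subset \mathrm{Lip}_{loc}(X)$ is *prevalent* if there is a Borel measure $\nu$ on $\mathrm{Lip}_{loc}(X)$, positive and finite on some compact set, such that for every $v\in\mathrm{Lip}_{loc}(X)$ we have $v+e\in\mathcal S$ for $\nu$-almost every $e$; an arbitrary set is prevalent if it contains a prevalent Borel set. **Theorem (almost sure time-delay prediction).** There is a prevalent set of observables $h\in\mathrm{Lip}_{loc}(X)$ such that for every $h$ in this set and every $k\in\mathbb N$ with $k>\dim_H\mu$, the observable $h$ is almost surely deterministically $k$-predictable with respect to $\mu$; moreover, there are a Borel set $X_h\subset X$ of full $\mu$-measure such that $\phi(X_h)$ is Borel, and a Borel prediction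 map $S\colon\phi(X_h)\to\phi(X)$, that is, $S\circ\phi=\phi\circ T$ on $X_h$, with the following properties. 1. If $\mu$ is $T$-invariant, then $T(X_h)\subset X_h$ and $S(\phi(X_h))\subset\phi(X_h)$. 2. If $X$ is compact and $k>\dim_H(\operatorname{supp}\mu)$, then $S$ is continuous on $\phi(X_h)$. -/

import Mathlib

open MeasureTheory Set
open scoped ENNReal Topology

noncomputable section

/-! ### Prevalence -/

/-- `S` is prevalent in the additive group `V` (with its Borel `σ`-algebra): it contains a Borel
set `B` for which there is a Borel measure `ν`, positive and finite on some compact set, such that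
for every `v` we have `v + e ∈ B` for `ν`-almost every `e`. -/
def IsPrevalent {V : Type*} [AddCommGroup V] [TopologicalSpace V] [MeasurableSpace V]
    [BorelSpace V] (S : Set V) : Prop :=
  ∃ B : Set V, B ⊆ S ∧ MeasurableSet B ∧
    ∃ ν : Measure V, (∃ K : Set V, IsCompact K ∧ 0 < ν K ∧ ν K < ∞) ∧
      ∀ v : V, ∀ᵐ e ∂ν, v + e ∈ B

/-! ### The space of locally Lipschitz observables -/

/-- A countable basis (enumerated, repetitions allowed) of the topology of `ℝ^N`, consisting of
bounded sets. -/
structure BoundedBasis (N : ℕ) where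
  /-- the `n`-th basic set -/
  set : ℕ → Set (EuclideanSpace ℝ (Fin N))
  isTopologicalBasis : TopologicalSpace.IsTopologicalBasis (range set)
  isBounded : ∀ n, Bornology.IsBounded (set n)

/-- The possibly infinite Lipschitz norm of `h` on `U ∩ X`:
`sup_{x ∈ U ∩ X} |h x| + sup_{x ≠ y ∈ U ∩ X} |h x - h y| / ‖x - y‖`. -/
def lipENorm {N : ℕ} {X : Set (EuclideanSpace ℝ (Fin N))}
    (U : Set (EuclideanSpace ℝ (Fin N))) (h : X → ℝ) : ℝ≥0∞ :=
  (⨆ (x : X) (_ : x.1 ∈ U), ENNReal.ofReal |h x|) +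
    ⨆ (x : X) (_ : x.1 ∈ U) (y : X) (_ : y.1 ∈ U) (_ : x ≠ y),
      ENNReal.ofReal (|h x - h y| / ‖x.1 - y.1‖)

theorem lipENorm_zero {N : ℕ} {X : Set (EuclideanSpace ℝ (Fin N))}
    (U : Set (EuclideanSpace ℝ (Fin N))) : lipENorm U (0 : X → ℝ) = 0 := by
  simp [lipENorm]

theorem lipENorm_neg {N : ℕ} {X : Set (EuclideanSpace ℝ (Fin N))}
    (U : Set (EuclideanSpace ℝ (Fin N))) (h : X → ℝ) : lipENorm U (-h) = lipENorm U h := by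
  have key : ∀ x y : X, |-h x - -h y| = |h x - h y| := fun x y => by
    rw [neg_sub_neg, abs_sub_comm]
  simp only [lipENorm, Pi.neg_apply, abs_neg, key]

theorem lipENorm_add_le {N : ℕ} {X : Set (EuclideanSpace ℝ (Fin N))}
    (U : Set (EuclideanSpace ℝ (Fin N))) (f g : X → ℝ) :
    lipENorm U (f + g) ≤ lipENorm U f + lipENorm U g := by
  unfold lipENorm
  rw [add_add_add_comm]
  refine add_le_add (iSup₂_le fun x hx => ?_) (iSup₂_le fun x hx => iSup₂_le fun y hy =>
    iSup_le fun hxy => ?_)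
  · calc ENNReal.ofReal |(f + g) x| ≤ ENNReal.ofReal (|f x| + |g x|) :=
          ENNReal.ofReal_le_ofReal (abs_add_le _ _)
      _ = ENNReal.ofReal |f x| + ENNReal.ofReal |g x| :=
          ENNReal.ofReal_add (abs_nonneg _) (abs_nonneg _)
      _ ≤ _ := add_le_add
          (le_iSup₂ (f := fun (x : X) (_ : x.1 ∈ U) => ENNReal.ofReal |f x|) x hx)
          (le_iSup₂ (f := fun (x : X) (_ : x.1 ∈ U) => ENNReal.ofReal |g x|) x hx)
  · have aux : ∀ u : X → ℝ, ENNReal.ofReal (|u x - u y| / ‖x.1 - y.1‖) ≤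
        ⨆ (x : X) (_ : x.1 ∈ U) (y : X) (_ : y.1 ∈ U) (_ : x ≠ y),
          ENNReal.ofReal (|u x - u y| / ‖x.1 - y.1‖) := fun u =>
      le_iSup₂_of_le x hx (le_iSup₂_of_le y hy (le_iSup_of_le hxy le_rfl))
    refine le_trans ?_ (add_le_add (aux f) (aux g))
    rw [← ENNReal.ofReal_add (by positivity) (by positivity), ← add_div]
    refine ENNReal.ofReal_le_ofReal (div_le_div_of_nonneg_right ?_ (norm_nonneg _))
    have : (f + g) x - (f + g) y = (f x - f y) + (g x - g y) := by
      simp only [Pi.add_apply]; ring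
    rw [this]
    exact abs_add_le _ _

/-- The linear space of locally Lipschitz functions `X → ℝ`. -/
def locLipSubmodule {N : ℕ} (X : Set (EuclideanSpace ℝ (Fin N))) : Submodule ℝ (X → ℝ) where
  carrier := {h | LocallyLipschitz h}
  add_mem' {f g} hf hg := by
    intro x
    obtain ⟨K, s, hs, hK⟩ := hf x
    obtain ⟨L, t, ht, hL⟩ := hg x
    exact ⟨K + L, s ∩ t, Filter.inter_mem hs ht,
      (hK.mono inter_subset_left).add (hL.mono inter_subset_right)⟩
  zero_mem' := LocallyLipschitz.const (0 : ℝ)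
  smul_mem' c f hf := by
    have : LocallyLipschitz fun y : ℝ => c • y := (lipschitzWith_smul c).locallyLipschitz
    exact this.comp hf

/-- The space `Lip_loc(X)` of locally Lipschitz observables, as a type of its own: it carries the
metric below, and not the topology of pointwise convergence. -/
def LocLip {N : ℕ} (X : Set (EuclideanSpace ℝ (Fin N))) (_B : BoundedBasis N) : Type :=
  locLipSubmodule X

namespace LocLip

variable {N : ℕ} {X : Set (EuclideanSpace ℝ (Fin N))} {B : BoundedBasis N}

instance : AddCommGroup (LocLip X B) := inferInstanceAs (AddCommGroup (locLipSubmodule X))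

instance : Module ℝ (LocLip X B) := inferInstanceAs (Module ℝ (locLipSubmodule X))

instance : CoeFun (LocLip X B) (fun _ => X → ℝ) := ⟨fun h => h.1⟩

/-- `∑_{n ≥ 1} 2^{-n} min {1, ‖f - g‖_{U_n ∩ X}}`, where `U_n` is the basic set number `n - 1`. -/
def edistFun (f g : LocLip X B) : ℝ≥0∞ :=
  ∑' n : ℕ, (2⁻¹ : ℝ≥0∞) ^ (n + 1) * min 1 (lipENorm (B.set n) (fun x : X => f x - g x))

theorem edistFun_self (f : LocLip X B) : edistFun f f = 0 := by
  have : (fun x : X => f x - f x) = 0 := by ext; simp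
  simp only [edistFun, this, lipENorm_zero]
  simp

theorem edistFun_comm (f g : LocLip X B) : edistFun f g = edistFun g f := by
  have : (fun x : X => f x - g x) = -(fun x : X => g x - f x) := by ext; simp
  simp only [edistFun, this, lipENorm_neg]

theorem edistFun_triangle (f g h : LocLip X B) :
    edistFun f h ≤ edistFun f g + edistFun g h := by
  have : (fun x : X => f x - h x) = (fun x : X => f x - g x) + (fun x : X => g x - h x) := by
    ext; simp
  unfold edistFun
  rw [← ENNReal.tsum_add, this]
  refine ENNReal.tsum_le_tsum fun n => ?_
  rw [← mul_add]
  refine mul_le_mul_right ?_ _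
  refine (min_le_min_left 1 (lipENorm_add_le _ _ _)).trans ?_
  rcases le_total 1 (lipENorm (B.set n) (fun x : X => f x - g x)) with h1 | h1
  · rw [min_eq_left h1]
    exact (min_le_left _ _).trans le_self_add
  rcases le_total 1 (lipENorm (B.set n) (fun x : X => g x - h x)) with h2 | h2
  · rw [min_eq_left h2]
    exact (min_le_left _ _).trans le_add_self
  rw [min_eq_right h1, min_eq_right h2]
  exact min_le_right _ _

theorem edistFun_ne_top (f g : LocLip X B) : edistFun f g ≠ ∞ := by
  have h1 : edistFun f g ≤ ∑' n : ℕ, (2⁻¹ : ℝ≥0∞) ^ (n + 1) :=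
    ENNReal.tsum_le_tsum fun n => mul_le_of_le_one_right' (min_le_left _ _)
  have h2 : ∑' n : ℕ, (2⁻¹ : ℝ≥0∞) ^ (n + 1) = 1 := ENNReal.tsum_geometric_add_one _ |>.trans (by
    rw [ENNReal.one_sub_inv_two, inv_inv]
    exact ENNReal.inv_mul_cancel (by simp) (by simp))
  exact ne_top_of_le_ne_top (h2 ▸ ENNReal.one_ne_top) h1

theorem eq_of_edistFun_eq_zero {f g : LocLip X B} (h : edistFun f g = 0) : f = g := by
  refine Subtype.ext (funext fun x => ?_)
  obtain ⟨_, ⟨n, rfl⟩, hx, -⟩ := B.isTopologicalBasis.exists_subset_of_mem_open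
    (mem_univ x.1) isOpen_univ
  have hn := ENNReal.tsum_eq_zero.1 h n
  have h0 : lipENorm (B.set n) (fun x : X => f x - g x) = 0 := by
    rcases mul_eq_zero.1 hn with h' | h'
    · simp at h'
    · rcases min_choice 1 (lipENorm (B.set n) (fun x : X => f x - g x)) with h'' | h''
      · rw [h''] at h'; simp at h'
      · rwa [h''] at h'
  have h1 : ENNReal.ofReal |f x - g x| = 0 := by
    have := (add_eq_zero.1 h0).1
    simp only [ENNReal.iSup_eq_zero] at this
    exact this x hx
  have h2 := abs_nonpos_iff.1 (ENNReal.ofReal_eq_zero.1 h1)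
  exact sub_eq_zero.1 h2

/-- The metric `d(f, g) = ∑_{n ≥ 1} 2^{-n} min {1, ‖f - g‖_{U_n ∩ X}}` on `Lip_loc(X)`. -/
instance : MetricSpace (LocLip X B) where
  dist f g := (edistFun f g).toReal
  edist f g := edistFun f g
  dist_self f := by simp [edistFun_self]
  dist_comm f g := by rw [edistFun_comm]
  dist_triangle f g h := by
    rw [← ENNReal.toReal_add (edistFun_ne_top f g) (edistFun_ne_top g h)]
    exact ENNReal.toReal_mono
      (ENNReal.add_ne_top.2 ⟨edistFun_ne_top f g, edistFun_ne_top g h⟩) (edistFun_triangle f g h)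
  edist_dist f g := (ENNReal.ofReal_toReal (edistFun_ne_top f g)).symm
  eq_of_dist_eq_zero {f g} h :=
    eq_of_edistFun_eq_zero
      (((ENNReal.toReal_eq_zero_iff _).1 h).resolve_right (edistFun_ne_top f g))

instance : MeasurableSpace (LocLip X B) := borel _

instance : BorelSpace (LocLip X B) := ⟨rfl⟩

end LocLip

/-! ### Delay coordinates and predictability -/

/-- The Hausdorff dimension of a measure on `ℝ^N`: the infimum of the Hausdorff dimensions of the
Borel sets of full measure. -/
def measureDimH {N : ℕ} (μ : Measure (EuclideanSpace ℝ (Fin N))) : ℝ≥0∞ :=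
  ⨅ (A : Set (EuclideanSpace ℝ (Fin N))) (_ : MeasurableSet A) (_ : μ Aᶜ = 0), dimH A

/-- The `k`-delay coordinate map `φ(x) = (h(x), h(Tx), …, h(T^{k-1} x))`. -/
def delayMap {α : Type*} (T : α → α) (h : α → ℝ) (k : ℕ) (x : α) : Fin k → ℝ :=
  fun i => h (T^[i] x)

/-- `h` is almost surely deterministically `k`-predictable with respect to `μ`. -/
def IsASDetPredictable {α : Type*} [MeasurableSpace α] (μ : Measure α) (T : α → α)
    (h : α → ℝ) (k : ℕ) : Prop :=
  ∃ A : Set α, MeasurableSet A ∧ μ Aᶜ = 0 ∧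
    ∀ x₁ ∈ A, ∀ x₂ ∈ A, delayMap T h k x₁ = delayMap T h k x₂ →
      delayMap T h k (T x₁) = delayMap T h k (T x₂)

/-- `S`, defined on `φ(A)`, is a prediction map: `φ(T x) = S(φ(x))` for all `x ∈ A`. (In
particular the values of `S` lie in `φ(T(A))`.) -/
def IsPredictionMap {α : Type*} (T : α → α) (h : α → ℝ) (k : ℕ) (A : Set α)
    (S : delayMap T h k '' A → (Fin k → ℝ)) : Prop :=
  ∀ (x : α) (hx : x ∈ A), S ⟨delayMap T h k x, mem_image_of_mem _ hx⟩ = delayMap T h k (T x)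

end

/-! Two points `x`, `y` with equal delay vectors are harmless if `h` agrees along their whole
forward orbits. Consider the formal differences of point masses `δ_{T^i x} - δ_{T^i y}` for `i < k`.

If they are linearly dependent, some difference lies in the span of the earlier ones. That span is
then invariant under push-forward by `T`, so it contains all later differences; `h` vanishes on it
once the delay vectors agree. Hence the coincidence propagates (`eq_of_not_linearIndependent`), with
no case distinction for periodic orbits.

If they are independent, coincidences are avoided almost surely by perturbing `h` with random
coefficients `α` in a finite family of polynomials that interpolates at `2k` points. In suitable `k`
directions of the coefficient space the perturbation acts on the delay difference by an invertible
matrix (`exists_det_delayMatrix_ne_zero`). For fixed `x`, the `k` parameters producing a coincidence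
with `y` are therefore a locally Lipschitz function of `y`; as `y` runs through a set of dimension
less than `k`, they fill only a null set (`volume_coincidence_eq_zero`). Fubini in `(α, x)` then
gives, for almost every `α`, a null set of bad `x` (`ae_measure_coincidence_eq_zero`). Since `x` is
fixed while `y` varies, only `k > dim` is needed, not `k > 2 dim`.

Lindelöf and σ-compact exhaustions reduce everything to countably many closed conditions, which also
makes the good set of observables Borel. σ-compactness of `X_h` makes `φ(X_h)` and `S` Borel;
compactness of the support makes `S` continuous. -/

/-! ### Linear dependence of delay differences -/

section Algebra

variable {X ι : Type*} [Fintype ι]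

/-- The differences of the point masses along the first `k` points of two orbits. -/
noncomputable def delayDiff (T : X → X) (k : ℕ) (x y : X) : Fin k → X →₀ ℝ :=
  fun i => Finsupp.single (T^[i] x) 1 - Finsupp.single (T^[i] y) 1

theorem linearCombination_delayDiff (T : X → X) (h : X → ℝ) {k : ℕ} (x y : X) (i : Fin k) :
    Finsupp.linearCombination ℝ h (delayDiff T k x y i) = h (T^[i] x) - h (T^[i] y) := by
  simp [delayDiff]

/-- If the delay differences of `x` and `y` are linearly dependent, then equality of the delay
vectors propagates to the whole forward orbits. -/
theorem eq_of_not_linearIndependent (T : X → X) (h : X → ℝ) {k : ℕ} {x y : X}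
    (hli : ¬ LinearIndependent ℝ (delayDiff T k x y))
    (hxy : delayMap T h k x = delayMap T h k y) (n : ℕ) : h (T^[n] x) = h (T^[n] y) := by
  induction k with
  | zero => exact absurd (linearIndependent_empty_type) hli
  | succ k ih =>
    have hsnoc : delayDiff T (k + 1) x y = Fin.snoc (delayDiff T k x y)
        (Finsupp.single (T^[k] x) 1 - Finsupp.single (T^[k] y) 1) := by
      ext1 i
      refine Fin.lastCases ?_ (fun i => ?_) i <;> simp [delayDiff]
    have hxy' : delayMap T h k x = delayMap T h k y :=
      funext fun i => congrFun hxy i.castSucc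
    rw [hsnoc, linearIndependent_finSnoc] at hli
    -- If the shorter family is already dependent, induction applies; otherwise the last difference
    -- lies in the span of the previous ones.
    by_cases hk : LinearIndependent ℝ (delayDiff T k x y)
    swap
    · exact ih hk hxy'
    have hmem : Finsupp.single (T^[k] x) (1 : ℝ) - Finsupp.single (T^[k] y) 1 ∈
        Submodule.span ℝ (range (delayDiff T k x y)) := by
      by_contra hcon
      exact hli ⟨hk, hcon⟩
    set W := Submodule.span ℝ (range (delayDiff T k x y)) with hW
    set τ : (X →₀ ℝ) →ₗ[ℝ] (X →₀ ℝ) := Finsupp.lmapDomain ℝ ℝ T with hτ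
    have hτs : ∀ m, τ (Finsupp.single (T^[m] x) 1 - Finsupp.single (T^[m] y) 1) =
        Finsupp.single (T^[m + 1] x) 1 - Finsupp.single (T^[m + 1] y) 1 := fun m => by
      rw [map_sub, hτ, Finsupp.lmapDomain_apply, Finsupp.lmapDomain_apply,
        Finsupp.mapDomain_single, Finsupp.mapDomain_single, Function.iterate_succ_apply',
        Function.iterate_succ_apply']
    have hlow : ∀ m, m < k → Finsupp.single (T^[m] x) (1 : ℝ) - Finsupp.single (T^[m] y) 1 ∈ W :=
      fun m hm => Submodule.subset_span ⟨⟨m, hm⟩, rfl⟩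
    -- Push-forward by `T` shifts each generator to the next, and the last generator to the
    -- dependent vector, so `W` is invariant.
    have hτW : W ≤ W.comap τ := by
      rw [hW, Submodule.span_le]
      rintro _ ⟨i, rfl⟩
      change τ (Finsupp.single (T^[i] x) 1 - Finsupp.single (T^[i] y) 1) ∈ W
      rw [hτs]
      rcases (Nat.succ_le_of_lt i.2).lt_or_eq with hi | hi
      · exact hlow _ hi
      · have : (i : ℕ) + 1 = k := hi
        rw [this]; exact hmem
    have hall : ∀ m, Finsupp.single (T^[m] x) (1 : ℝ) - Finsupp.single (T^[m] y) 1 ∈ W := by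
      intro m
      induction m with
      | zero =>
        rcases Nat.eq_zero_or_pos k with rfl | hk0
        · exact hmem
        · exact hlow 0 hk0
      | succ m ihm => rw [← hτs]; exact hτW ihm
    have hker : W ≤ LinearMap.ker (Finsupp.linearCombination ℝ h) := by
      rw [hW, Submodule.span_le]
      rintro _ ⟨i, rfl⟩
      simp only [SetLike.mem_coe, LinearMap.mem_ker, linearCombination_delayDiff]
      exact sub_eq_zero.2 (congrFun hxy' i)
    have := hker (hall n)
    simp only [LinearMap.mem_ker, map_sub, Finsupp.linearCombination_single, one_smul] at this
    exact sub_eq_zero.1 this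

/-- The linear combination of the functions `g j` with coefficients `a j`. -/
def combo (g : ι → X → ℝ) (a : ι → ℝ) (x : X) : ℝ := ∑ j, a j * g j x

theorem combo_add (g : ι → X → ℝ) (a b : ι → ℝ) (x : X) :
    combo g (a + b) x = combo g a x + combo g b x := by
  simp [combo, add_mul, Finset.sum_add_distrib]

theorem combo_smul (g : ι → X → ℝ) (c : ℝ) (a : ι → ℝ) (x : X) :
    combo g (c • a) x = c * combo g a x := by
  simp [combo, Finset.mul_sum, mul_assoc]

theorem combo_sum {κ : Type*} (s : Finset κ) (g : ι → X → ℝ) (a : κ → ι → ℝ) (x : X) :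
    combo g (∑ i ∈ s, a i) x = ∑ i ∈ s, combo g (a i) x := by
  simp only [combo, Finset.sum_apply, Finset.sum_mul]
  exact Finset.sum_comm

/-- The span of the functions `g j` interpolates arbitrary values at any `n` points. -/
def Interpolates (n : ℕ) (g : ι → X → ℝ) : Prop :=
  ∀ s : Finset X, s.card ≤ n → ∀ c : X → ℝ, ∃ a : ι → ℝ, ∀ x ∈ s, combo g a x = c x

/-- The matrix of the functionals `combo g (a i)` on the delay differences of `x` and `y`. -/
def delayMatrix (T : X → X) (g : ι → X → ℝ) {k : ℕ} (a : Fin k → ι → ℝ) (x y : X) :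
    Matrix (Fin k) (Fin k) ℝ :=
  Matrix.of fun l i => combo g (a i) (T^[l] x) - combo g (a i) (T^[l] y)

/-- Independence provides `k` linear functionals dual to the delay differences. Only their values on
the point masses of the at most `2k` orbit points matter, so they can be realised by interpolation,
and the matrix becomes the identity. -/
theorem exists_det_delayMatrix_ne_zero (T : X → X) {g : ι → X → ℝ} {k n : ℕ} (hkn : 2 * k ≤ n)
    (hg : Interpolates n g) {x y : X} (hli : LinearIndependent ℝ (delayDiff T k x y)) :
    ∃ a : Fin k → ι → ℝ, (delayMatrix T g a x y).det ≠ 0 := by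
  classical
  obtain ⟨f, hf⟩ : ∃ f : (X →₀ ℝ) →ₗ[ℝ] (Fin k → ℝ), ∀ l, f (delayDiff T k x y l) =
      Pi.single l 1 := by
    obtain ⟨f, hf⟩ := LinearMap.exists_extend
      ((Module.Basis.span hli).constr ℝ (fun l => (Pi.single l 1 : Fin k → ℝ)))
    refine ⟨f, fun l => ?_⟩
    have h1 := congrArg (fun φ => φ (Module.Basis.span hli l)) hf
    simp only [LinearMap.comp_apply, Module.Basis.constr_basis] at h1
    rw [← h1]
    simp [Module.Basis.span_apply]
  set s : Finset X := Finset.univ.image (fun l : Fin k => T^[l] x) ∪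
    Finset.univ.image (fun l : Fin k => T^[l] y)
  have hs : s.card ≤ n := by
    refine (Finset.card_union_le _ _).trans (le_trans ?_ hkn)
    have h1 := Finset.card_image_le (s := Finset.univ) (f := fun l : Fin k => T^[l] x)
    have h2 := Finset.card_image_le (s := Finset.univ) (f := fun l : Fin k => T^[l] y)
    simp only [Finset.card_univ, Fintype.card_fin] at h1 h2
    omega
  choose a ha using fun i : Fin k => hg s hs (fun z => f (Finsupp.single z 1) i)
  refine ⟨a, ?_⟩
  have : delayMatrix T g a x y = 1 := by
    ext l i
    have hx : T^[l] x ∈ s := Finset.mem_union_left _ (Finset.mem_image_of_mem _ (Finset.mem_univ l))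
    have hy : T^[l] y ∈ s :=
      Finset.mem_union_right _ (Finset.mem_image_of_mem _ (Finset.mem_univ l))
    rw [delayMatrix, Matrix.of_apply, ha i _ hx, ha i _ hy, ← Pi.sub_apply, ← map_sub]
    have := congrFun (hf l) i
    rw [delayDiff] at this
    rw [this, Matrix.one_apply, Pi.single_apply]
    simp [eq_comm]
  rw [this, Matrix.det_one]
  exact one_ne_zero

end Algebra

/-! ### An interpolating family of polynomials -/

section Interpolation

variable {N : ℕ}

/-- The constant `1`, the squared norm and the coordinates. -/
noncomputable def quadricFun : Option (Option (Fin N)) → EuclideanSpace ℝ (Fin N) → ℝ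
  | none, _ => 1
  | some none, x => ‖x‖ ^ 2
  | some (some i), x => x i

/-- Products of `n` functions, each of which is `1`, the squared norm or a coordinate. -/
noncomputable def quadricProd (n : ℕ) (σ : Fin n → Option (Option (Fin N)))
    (x : EuclideanSpace ℝ (Fin N)) : ℝ := ∏ t, quadricFun (σ t) x

theorem contDiff_quadricProd (n : ℕ) (σ : Fin n → Option (Option (Fin N))) :
    ContDiff ℝ 1 (quadricProd n σ) := by
  unfold quadricProd
  refine contDiff_prod fun t _ => ?_
  rcases σ t with _ | _ | i
  · exact contDiff_const
  · exact contDiff_norm_sq ℝ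
  · exact contDiff_piLp_apply 2

/-- Coefficients of `‖x - p‖ ^ 2` (or of the constant `1`) in terms of `quadricFun`. -/
noncomputable def distSqCoeff : Option (EuclideanSpace ℝ (Fin N)) → Option (Option (Fin N)) → ℝ
  | none, none => 1
  | none, some _ => 0
  | some p, none => ‖p‖ ^ 2
  | some _, some none => 1
  | some p, some (some i) => -2 * p i

theorem sum_distSqCoeff_none (x : EuclideanSpace ℝ (Fin N)) :
    ∑ s, distSqCoeff none s * quadricFun s x = 1 := by
  simp [Fintype.sum_option, distSqCoeff, quadricFun]

theorem sum_distSqCoeff_some (p x : EuclideanSpace ℝ (Fin N)) :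
    ∑ s, distSqCoeff (some p) s * quadricFun s x = ‖x - p‖ ^ 2 := by
  simp only [Fintype.sum_option, distSqCoeff, quadricFun, mul_one, one_mul]
  rw [@norm_sub_sq_real, PiLp.inner_apply]
  simp only [RCLike.inner_apply, conj_trivial, Finset.mul_sum]
  rw [show ∑ i, -2 * p i * x i = -∑ i, 2 * (p i * x i) by
    rw [← Finset.sum_neg_distrib]; exact Finset.sum_congr rfl fun i _ => by ring]
  ring

theorem combo_quadricProd (n : ℕ) (q : Fin n → Option (EuclideanSpace ℝ (Fin N)))
    (x : EuclideanSpace ℝ (Fin N)) :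
    combo (quadricProd n) (fun σ => ∏ t, distSqCoeff (q t) (σ t)) x =
      ∏ t, ∑ s, distSqCoeff (q t) s * quadricFun s x := by
  rw [Finset.prod_univ_sum, Fintype.piFinset_univ, combo]
  simp only [quadricProd, Finset.prod_mul_distrib]

/-- Lagrange interpolation: the product of `‖x - r‖ ^ 2` over the nodes `r ≠ p` vanishes at every
node except `p`, and it expands into products of `quadricFun`. -/
theorem interpolates_quadricProd (N n : ℕ) : Interpolates n (quadricProd (N := N) n) := by
  classical
  intro s hs c
  have hL : ∀ p ∈ s, ∃ a : (Fin n → Option (Option (Fin N))) → ℝ,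
      ∀ x ∈ s, combo (quadricProd n) a x = if x = p then c p else 0 := by
    intro p hp
    -- The other nodes, padded by `none`: a surplus factor is the constant `1`, so there are always
    -- exactly `n` factors.
    set q : Fin n → Option (EuclideanSpace ℝ (Fin N)) := fun t => (s.erase p).toList[(t : ℕ)]?
    set b : (Fin n → Option (Option (Fin N))) → ℝ := fun σ => ∏ t, distSqCoeff (q t) (σ t) with hb
    have hbp : combo (quadricProd n) b p ≠ 0 := by
      rw [hb, combo_quadricProd]
      refine Finset.prod_ne_zero_iff.2 fun t _ => ?_
      rcases hq : q t with _ | r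
      · rw [sum_distSqCoeff_none]; exact one_ne_zero
      · rw [sum_distSqCoeff_some]
        have hr : r ∈ (s.erase p).toList := List.mem_of_getElem? hq
        rw [Finset.mem_toList, Finset.mem_erase] at hr
        exact pow_ne_zero _ (norm_ne_zero_iff.2 (sub_ne_zero.2 hr.1.symm))
    refine ⟨(c p / combo (quadricProd n) b p) • b, fun x hx => ?_⟩
    rw [combo_smul]
    split_ifs with hxp
    · rw [hxp, div_mul_cancel₀ _ hbp]
    · have hx' : x ∈ (s.erase p).toList := Finset.mem_toList.2 (Finset.mem_erase.2 ⟨hxp, hx⟩)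
      obtain ⟨t, ht, htx⟩ := List.mem_iff_getElem.1 hx'
      have htn : t < n := by
        rw [Finset.length_toList] at ht
        exact ht.trans_le ((Finset.card_erase_le).trans hs)
      have hqt : q ⟨t, htn⟩ = some x := by
        rw [← htx]; exact List.getElem?_eq_getElem ht
      have hbx : combo (quadricProd n) b x = 0 := by
        rw [hb, combo_quadricProd, Finset.prod_eq_zero (Finset.mem_univ ⟨t, htn⟩)]
        rw [hqt, sum_distSqCoeff_some, sub_self, norm_zero]
        norm_num
      rw [hbx, mul_zero]
  choose! a ha using hL
  refine ⟨∑ p ∈ s, a p, fun x hx => ?_⟩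
  rw [combo_sum, Finset.sum_congr rfl fun p hp => ha p hp x hx]
  simp [hx]

theorem Interpolates.restrict {E ι : Type*} [Fintype ι] {n : ℕ} {g : ι → E → ℝ}
    (hg : Interpolates n g) (X : Set E) : Interpolates n (fun j (x : X) => g j x) := by
  intro s hs c
  obtain ⟨a, ha⟩ := hg (s.map (Function.Embedding.subtype _)) (by simpa using hs)
    (Function.extend Subtype.val c 0)
  refine ⟨a, fun x hx => ?_⟩
  have := ha x (Finset.mem_map_of_mem _ hx)
  rw [Subtype.val_injective.extend_apply] at this
  exact this

end Interpolation

/-! ### Null sets of parameters -/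

section NullParameters

/-- A measurable set is null as soon as all its slices along a continuous family of translations
are null. -/
theorem volume_eq_zero_of_slices {ι κ : Type*} [Fintype ι] [Fintype κ] {E : Set (ι → ℝ)}
    (hE : MeasurableSet E) {R : (κ → ℝ) → ι → ℝ} (hR : Continuous R)
    (h : ∀ α, volume {t | α + R t ∈ E} = 0) : volume E = 0 := by
  have hZ : MeasurableSet {p : (κ → ℝ) × (ι → ℝ) | p.2 + R p.1 ∈ E} :=
    hE.preimage (continuous_snd.add (hR.comp continuous_fst)).measurable
  have h0 : ((volume : Measure (κ → ℝ)).prod (volume : Measure (ι → ℝ)))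
      {p | p.2 + R p.1 ∈ E} = 0 := by
    rw [Measure.prod_apply_symm hZ]
    simp only [preimage_ofPred_eq, h, lintegral_zero]
  have h1 := Measure.measure_ae_null_of_prod_null h0
  -- One good `t` suffices, because its slice in `α` is a translate of `E`.
  obtain ⟨t, ht⟩ := h1.exists
  have h2 : (volume : Measure (ι → ℝ)) ((fun α => α + R t) ⁻¹' E) = 0 := ht
  rwa [measure_preimage_add_right] at h2

/-- `ℝ^k`-valued images of sets of dimension less than `k` under maps which are locally Lipschitz
on the set are Lebesgue null. -/
theorem volume_image_eq_zero {Y : Type*} [MetricSpace Y] [SecondCountableTopology Y] {k : ℕ}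
    {f : Y → Fin k → ℝ} {s : Set Y} (hs : dimH s < k)
    (hf : ∀ y ∈ s, ∃ C, ∃ t ∈ 𝓝[s] y, LipschitzOnWith C f t) : volume (f '' s) = 0 := by
  have h1 : dimH (f '' s) < ((k : NNReal) : ℝ≥0∞) := by
    simpa using (dimH_image_le_of_locally_lipschitzOn hf).trans_lt hs
  have h2 := hausdorffMeasure_of_dimH_lt h1
  have h3 := hausdorffMeasure_pi_real (ι := Fin k)
  rw [Fintype.card_fin] at h3
  rw [← h3]
  simpa using h2

/-- Projections along a compact set of closed sets are closed. -/
theorem isClosed_exists_mem_of_isCompact {P Y : Type*} [TopologicalSpace P] [TopologicalSpace Y]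
    {K : Set Y} (hK : IsCompact K) {S : Set (P × Y)} (hS : IsClosed S) :
    IsClosed {p | ∃ y ∈ K, (p, y) ∈ S} := by
  have := isCompact_iff_compactSpace.1 hK
  have h1 : IsClosed {q : P × K | (q.1, (q.2 : Y)) ∈ S} :=
    hS.preimage (continuous_fst.prodMk (continuous_subtype_val.comp continuous_snd))
  convert isClosedMap_fst_of_compactSpace _ h1 using 1
  ext p
  constructor
  · rintro ⟨y, hy, hp⟩
    exact ⟨(p, ⟨y, hy⟩), hp, rfl⟩
  · rintro ⟨⟨p', y⟩, hp, rfl⟩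
    exact ⟨y, y.2, hp⟩

theorem LocallyLipschitz.exists_lipschitzOnWith_comp {Y : Type*} [PseudoMetricSpace Y]
    {E F : Type*} [PseudoMetricSpace E] [PseudoMetricSpace F] {f : Y → E}
    (hf : LocallyLipschitz f) {Φ : E → F} {y : Y} (hΦ : ∃ C, ∃ t ∈ 𝓝 (f y), LipschitzOnWith C Φ t) :
    ∃ C, ∃ t ∈ 𝓝 y, LipschitzOnWith C (Φ ∘ f) t := by
  obtain ⟨C, t, ht, hC⟩ := hΦ
  obtain ⟨D, s, hs, hD⟩ := hf y
  exact ⟨C * D, s ∩ f ⁻¹' t, Filter.inter_mem hs (hf.continuous.continuousAt ht),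
    hC.comp (hD.mono inter_subset_left) fun z hz => hz.2⟩

theorem locallyLipschitz_pi {Y κ F : Type*} [Fintype κ] [PseudoMetricSpace Y] [PseudoMetricSpace F]
    {f : Y → κ → F}
    (hf : ∀ i, LocallyLipschitz fun y => f y i) : LocallyLipschitz f := by
  intro y
  choose C t ht hC using fun i => hf i y
  refine ⟨∑ i, C i, ⋂ i, t i, Filter.iInter_mem.2 ht, fun z hz w hw => ?_⟩
  rw [edist_pi_def]
  refine Finset.sup_le fun i _ => ?_
  refine (hC i (mem_iInter.1 hz i) (mem_iInter.1 hw i)).trans ?_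
  gcongr
  exact Finset.single_le_sum (f := C) (fun _ _ => zero_le) (Finset.mem_univ i)

/-- Solutions of a linear system depend in a locally Lipschitz way on the system. -/
theorem exists_lipschitzOnWith_inv_mulVec {Y : Type*} [PseudoMetricSpace Y] {k : ℕ}
    {M : Y → Matrix (Fin k) (Fin k) ℝ} {c : Y → Fin k → ℝ}
    (hM : ∀ i j, LocallyLipschitz fun y => M y i j) (hc : ∀ i, LocallyLipschitz fun y => c y i)
    {y : Y} (hy : (M y).det ≠ 0) :
    ∃ C, ∃ t ∈ 𝓝 y, LipschitzOnWith C (fun y => (M y)⁻¹.mulVec (c y)) t := by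
  let Φ : ((Fin k → Fin k → ℝ) × (Fin k → ℝ)) → Fin k → ℝ :=
    fun p => (Matrix.of p.1)⁻¹.mulVec p.2
  have hdet : ∀ (A : (Fin k → Fin k → ℝ) × (Fin k → ℝ) → Matrix (Fin k) (Fin k) ℝ),
      (∀ i j, ContDiff ℝ 1 fun p => A p i j) → ContDiff ℝ 1 fun p => (A p).det := by
    intro A hA
    simp only [Matrix.det_apply]
    refine ContDiff.sum fun σ _ => ContDiff.const_smul _ (contDiff_prod fun i _ => hA _ _)
  have hfst : ∀ i j, ContDiff ℝ 1
      fun p : (Fin k → Fin k → ℝ) × (Fin k → ℝ) => Matrix.of p.1 i j := fun i j => by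
    simp only [Matrix.of_apply]
    fun_prop
  have hadj : ∀ i j, ContDiff ℝ 1
      fun p : (Fin k → Fin k → ℝ) × (Fin k → ℝ) => (Matrix.of p.1).adjugate i j := fun i j => by
    simp only [Matrix.adjugate_apply]
    refine hdet _ fun i' j' => ?_
    by_cases h : i' = j
    · subst h
      simp only [Matrix.updateRow_self]
      exact contDiff_const
    · simp only [Matrix.updateRow_ne h]
      exact hfst _ _
  have hΦ : ContDiffAt ℝ 1 Φ (fun i j => M y i j, c y) := by
    rw [contDiffAt_pi]
    intro i
    -- Cramer's formula: the solution is a polynomial expression divided by the determinant, hence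
    -- continuously differentiable where the determinant is nonzero.
    have : (fun p => Φ p i) = fun p : (Fin k → Fin k → ℝ) × (Fin k → ℝ) =>
        ∑ j, ((Matrix.of p.1).det)⁻¹ * (Matrix.of p.1).adjugate i j * p.2 j := by
      ext p
      simp [Φ, Matrix.inv_def, Matrix.mulVec, dotProduct, Ring.inverse_eq_inv']
    rw [this]
    have hinv : ContDiffAt ℝ 1 (fun p : (Fin k → Fin k → ℝ) × (Fin k → ℝ) =>
        ((Matrix.of p.1).det)⁻¹) (fun i j => M y i j, c y) :=
      (hdet _ hfst).contDiffAt.inv hy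
    refine ContDiffAt.sum fun j _ => (hinv.mul (hadj i j).contDiffAt).mul ?_
    fun_prop
  have hf : LocallyLipschitz fun y => ((fun i j => M y i j : Fin k → Fin k → ℝ), c y) := by
    exact (locallyLipschitz_pi fun i => locallyLipschitz_pi (hM i)).prodMk (locallyLipschitz_pi hc)
  exact hf.exists_lipschitzOnWith_comp hΦ.exists_lipschitzOnWith

end NullParameters

/-! ### Fubini estimates for coincidences of delay vectors -/

section Slices

variable {X ι : Type*} [Fintype ι] [MetricSpace X]
  {T : X → X} {g : ι → X → ℝ} {k : ℕ}

theorem LocallyLipschitz.real_add {Y : Type*} [PseudoMetricSpace Y] {f₁ f₂ : Y → ℝ}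
    (h₁ : LocallyLipschitz f₁) (h₂ : LocallyLipschitz f₂) :
    LocallyLipschitz fun y => f₁ y + f₂ y := fun y => by
  obtain ⟨C, s, hs, hC⟩ := h₁ y
  obtain ⟨D, t, ht, hD⟩ := h₂ y
  exact ⟨C + D, s ∩ t, Filter.inter_mem hs ht,
    (hC.mono inter_subset_left).add (hD.mono inter_subset_right)⟩

theorem LocallyLipschitz.const_mul {Y : Type*} [PseudoMetricSpace Y] {f : Y → ℝ}
    (hf : LocallyLipschitz f) (c : ℝ) : LocallyLipschitz fun y => c * f y := by
  have : LocallyLipschitz fun y : ℝ => c • y := (lipschitzWith_smul c).locallyLipschitz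
  exact this.comp hf

theorem LocallyLipschitz.const_sub {Y : Type*} [PseudoMetricSpace Y] {f : Y → ℝ}
    (hf : LocallyLipschitz f) (c : ℝ) : LocallyLipschitz fun y => c - f y := by
  simpa [sub_eq_add_neg] using (LocallyLipschitz.const c).real_add (hf.const_mul (-1))

theorem locallyLipschitz_combo {Y : Type*} [PseudoMetricSpace Y] {g : ι → Y → ℝ}
    (hg : ∀ j, LocallyLipschitz (g j)) (a : ι → ℝ) : LocallyLipschitz (combo g a) := by
  classical
  have : ∀ s : Finset ι, LocallyLipschitz fun y => ∑ j ∈ s, a j * g j y := by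
    intro s
    induction s using Finset.induction_on with
    | empty => simpa using LocallyLipschitz.const (0 : ℝ)
    | insert j s hj ih =>
      simp only [Finset.sum_insert hj]
      exact ((hg j).const_mul (a j)).real_add ih
  exact this Finset.univ

theorem locallyLipschitz_iterate (hT : LocallyLipschitz T) (n : ℕ) : LocallyLipschitz T^[n] := by
  induction n with
  | zero => exact LocallyLipschitz.id
  | succ n ih => rw [Function.iterate_succ]; exact ih.comp hT

theorem continuous_combo_left {Y : Type*} (g : ι → Y → ℝ) (y : Y) :
    Continuous fun α => combo g α y := by
  unfold combo
  fun_prop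

theorem continuous_combo (hg : ∀ j, LocallyLipschitz (g j)) :
    Continuous fun p : (ι → ℝ) × X => combo g p.1 p.2 := by
  have := fun j => (hg j).continuous
  unfold combo
  fun_prop

variable [SecondCountableTopology X]

/-- For almost every parameter `α`, no point `y ∈ K` which is in general position with respect to
the fixed point `x` has the same delay vector as `x`. -/
theorem volume_coincidence_eq_zero (hT : LocallyLipschitz T) (hg : ∀ j, LocallyLipschitz (g j))
    {K : Set X} (hK : IsCompact K) (hdim : dimH K < k) (a : Fin k → ι → ℝ) {C : Set (X × X)}
    (hC : IsClosed C) (hCa : ∀ p ∈ C, (delayMatrix T g a p.1 p.2).det ≠ 0) {v : X → ℝ}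
    (hv : LocallyLipschitz v) (x : X) :
    volume {α : ι → ℝ | ∃ y ∈ K, (x, y) ∈ C ∧
      delayMap T (fun z => v z + combo g α z) k x =
        delayMap T (fun z => v z + combo g α z) k y} = 0 := by
  have hTi : ∀ i, Continuous T^[i] := fun i => (locallyLipschitz_iterate hT i).continuous
  have hgc := continuous_combo hg
  have hvc := hv.continuous
  have hcl : IsClosed {p : (ι → ℝ) × X | (x, p.2) ∈ C ∧
      delayMap T (fun z => v z + combo g p.1 z) k x =
        delayMap T (fun z => v z + combo g p.1 z) k p.2} := by
    refine (hC.preimage (by fun_prop)).inter (isClosed_eq ?_ ?_)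
    · refine continuous_pi fun i => ?_
      exact continuous_const.add ((continuous_combo_left g _).comp continuous_fst)
    · refine continuous_pi fun i => ?_
      exact (hvc.comp ((hTi i).comp continuous_snd)).add
        (hgc.comp (continuous_fst.prodMk ((hTi i).comp continuous_snd)))
  have hE := isClosed_exists_mem_of_isCompact hK hcl
  refine volume_eq_zero_of_slices (κ := Fin k) (R := fun t => ∑ i, t i • a i) hE.measurableSet
    (by fun_prop) fun α => ?_
  set c : X → Fin k → ℝ := fun y l => (v (T^[l] x) + combo g α (T^[l] x)) -
    (v (T^[l] y) + combo g α (T^[l] y)) with hc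
  have hcL : ∀ l, LocallyLipschitz fun y => c y l := fun l =>
    ((hv.comp (locallyLipschitz_iterate hT l)).real_add
      ((locallyLipschitz_combo hg α).comp (locallyLipschitz_iterate hT l))).const_sub _
  have hML : ∀ l i, LocallyLipschitz fun y => delayMatrix T g a x y l i := fun l i =>
    ((locallyLipschitz_combo hg (a i)).comp (locallyLipschitz_iterate hT l)).const_sub _
  -- A coincidence at the parameter `α + ∑ i, t i • a i` is the linear system `M t = -c y` with `M`
  -- the delay matrix, so `t` is determined by `y`.
  set f : X → Fin k → ℝ := fun y => (delayMatrix T g a x y)⁻¹.mulVec (-c y) with hf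
  have hcL' : ∀ l, LocallyLipschitz fun y => (-c y) l := fun l => by
    simpa using (hcL l).const_mul (-1)
  have hnull : volume (f '' {y ∈ K | (x, y) ∈ C}) = 0 := by
    refine volume_image_eq_zero ((dimH_mono fun y hy => hy.1).trans_lt hdim) fun y hy => ?_
    obtain ⟨D, t, ht, hD⟩ := exists_lipschitzOnWith_inv_mulVec hML hcL' (hCa _ hy.2)
    exact ⟨D, t, mem_nhdsWithin_of_mem_nhds ht, hD⟩
  refine measure_mono_null ?_ hnull
  rintro t ⟨y, hyK, hyC, hy⟩
  refine ⟨y, ⟨hyK, hyC⟩, ?_⟩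
  have hdet : IsUnit (delayMatrix T g a x y).det := isUnit_iff_ne_zero.2 (hCa _ hyC)
  have hsys : (delayMatrix T g a x y).mulVec t = -c y := by
    ext l
    have := congrFun hy l
    simp only [delayMap, combo_add, combo_sum, combo_smul] at this
    simp only [delayMatrix, Matrix.mulVec, dotProduct, Matrix.of_apply, sub_mul,
      Finset.sum_sub_distrib, hc, Pi.neg_apply]
    simp only [mul_comm (t _)] at this
    linarith
  rw [hf]
  simp only
  rw [← hsys, Matrix.mulVec_mulVec, Matrix.nonsing_inv_mul _ hdet, Matrix.one_mulVec]

variable [MeasurableSpace X] [BorelSpace X]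

/-- For almost every parameter `α`, almost no point `x ∈ K` has the same delay vector as some
`y ∈ K` in general position with respect to `x`. -/
theorem ae_measure_coincidence_eq_zero (μ : Measure X) [SFinite μ] (hT : LocallyLipschitz T)
    (hg : ∀ j, LocallyLipschitz (g j))
    {K : Set X} (hK : IsCompact K) (hdim : dimH K < k) (a : Fin k → ι → ℝ) {C : Set (X × X)}
    (hC : IsClosed C) (hCa : ∀ p ∈ C, (delayMatrix T g a p.1 p.2).det ≠ 0) {v : X → ℝ}
    (hv : LocallyLipschitz v) :
    ∀ᵐ α : ι → ℝ, μ {x | ∃ y ∈ K, (x, y) ∈ C ∧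
      delayMap T (fun z => v z + combo g α z) k x =
        delayMap T (fun z => v z + combo g α z) k y} = 0 := by
  have hTi : ∀ i, Continuous T^[i] := fun i => (locallyLipschitz_iterate hT i).continuous
  have hgc := continuous_combo hg
  have hvc := hv.continuous
  have hdm : Continuous fun p : (ι → ℝ) × X => delayMap T (fun z => v z + combo g p.1 z) k p.2 :=
    continuous_pi fun i => (hvc.comp ((hTi i).comp continuous_snd)).add
        (hgc.comp (continuous_fst.prodMk ((hTi i).comp continuous_snd)))
  have hcl : IsClosed {p : ((ι → ℝ) × X) × X | (p.1.2, p.2) ∈ C ∧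
      delayMap T (fun z => v z + combo g p.1.1 z) k p.1.2 =
        delayMap T (fun z => v z + combo g p.1.1 z) k p.2} :=
    (hC.preimage (by fun_prop)).inter (isClosed_eq (hdm.comp continuous_fst)
      (hdm.comp ((continuous_fst.comp continuous_fst).prodMk continuous_snd)))
  -- Compactness of `K` makes this projection closed, which gives the joint measurability that
  -- Fubini requires.
  set Z : Set ((ι → ℝ) × X) := {p | ∃ y ∈ K, (p.2, y) ∈ C ∧
      delayMap T (fun z => v z + combo g p.1 z) k p.2 =
        delayMap T (fun z => v z + combo g p.1 z) k y}
  have hZ : MeasurableSet Z := (isClosed_exists_mem_of_isCompact hK hcl).measurableSet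
  refine Measure.measure_ae_null_of_prod_null (μ := volume) (ν := μ) (s := Z) ?_
  rw [Measure.prod_apply_symm hZ]
  refine lintegral_eq_zero_of_ae_eq_zero (Filter.Eventually.of_forall fun x => ?_)
  exact volume_coincidence_eq_zero hT hg hK hdim a hC hCa hv x

end Slices

/-! ### Topology of the space of observables -/

section LocLipTopology

variable {N : ℕ} {X : Set (EuclideanSpace ℝ (Fin N))} {B : BoundedBasis N}

theorem lipENorm_smul_le (U : Set (EuclideanSpace ℝ (Fin N))) (c : ℝ) (h : X → ℝ) :
    lipENorm U (fun x => c * h x) ≤ ENNReal.ofReal |c| * lipENorm U h := by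
  unfold lipENorm
  rw [mul_add]
  refine add_le_add (iSup₂_le fun x hx => ?_) (iSup₂_le fun x hx => iSup₂_le fun y hy =>
    iSup_le fun hxy => ?_)
  · rw [abs_mul, ENNReal.ofReal_mul (abs_nonneg c)]
    gcongr
    exact le_iSup₂ (f := fun (x : X) (_ : x.1 ∈ U) => ENNReal.ofReal |h x|) x hx
  · rw [← mul_sub, abs_mul, mul_div_assoc, ENNReal.ofReal_mul (abs_nonneg c)]
    gcongr
    exact le_iSup₂_of_le x hx (le_iSup₂_of_le y hy (le_iSup_of_le hxy le_rfl))

theorem ofReal_abs_le_lipENorm {U : Set (EuclideanSpace ℝ (Fin N))} (h : X → ℝ) {x : X}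
    (hx : x.1 ∈ U) : ENNReal.ofReal |h x| ≤ lipENorm U h :=
  (le_iSup₂ (f := fun (x : X) (_ : x.1 ∈ U) => ENNReal.ofReal |h x|) x hx).trans le_self_add

/-- Continuously differentiable functions have finite Lipschitz norm on bounded sets. -/
theorem lipENorm_ne_top {U : Set (EuclideanSpace ℝ (Fin N))} (hU : Bornology.IsBounded U)
    {f : EuclideanSpace ℝ (Fin N) → ℝ} (hf : ContDiff ℝ 1 f) :
    lipENorm U (fun x : X => f x) ≠ ∞ := by
  have hc : IsCompact (closure U) := hU.isCompact_closure
  obtain ⟨L, hL⟩ := hf.locallyLipschitz.locallyLipschitzOn.exists_lipschitzOnWith_of_compact hc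
  obtain ⟨M, hM⟩ := hc.exists_bound_of_continuousOn hf.continuous.continuousOn
  refine ne_top_of_le_ne_top (b := ENNReal.ofReal M + ENNReal.ofReal L) (by simp) ?_
  refine add_le_add (iSup₂_le fun x hx => ?_) (iSup₂_le fun x hx => iSup₂_le fun y hy =>
    iSup_le fun hxy => ?_)
  · exact ENNReal.ofReal_le_ofReal (hM x (subset_closure hx))
  · refine ENNReal.ofReal_le_ofReal (div_le_of_le_mul₀ (norm_nonneg _) L.2 ?_)
    have := hL.dist_le_mul x (subset_closure hx) y (subset_closure hy)
    rwa [Real.dist_eq, dist_eq_norm] at this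

namespace LocLip

theorem edist_eq (f h : LocLip X B) : edist f h = edistFun f h := rfl

theorem coe_add (f h : LocLip X B) (x : X) : (f + h) x = f x + h x := rfl

theorem min_lipENorm_le_edist (n : ℕ) (f h : LocLip X B) :
    (2⁻¹ : ℝ≥0∞) ^ (n + 1) * min 1 (lipENorm (B.set n) (fun x : X => f x - h x)) ≤ edist f h :=
  ENNReal.le_tsum n

/-- One summand of the metric controls the supremum over a basic neighbourhood of the point, so
convergence of observables is locally uniform. -/
theorem continuous_eval : Continuous fun p : LocLip X B × X => p.1 p.2 := by
  rw [continuous_iff_continuousAt]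
  rintro ⟨h, x⟩
  obtain ⟨_, ⟨n, rfl⟩, hx, -⟩ := B.isTopologicalBasis.exists_subset_of_mem_open
    (mem_univ x.1) isOpen_univ
  have hopen : IsOpen (B.set n) := B.isTopologicalBasis.isOpen ⟨n, rfl⟩
  have h1 : Filter.Tendsto (fun p : LocLip X B × X => p.1 p.2 - h p.2) (𝓝 (h, x)) (𝓝 0) := by
    rw [Metric.tendsto_nhds]
    intro ε hε
    set δ : ℝ≥0∞ := (2⁻¹ : ℝ≥0∞) ^ (n + 1) * min 1 (ENNReal.ofReal ε) with hδ
    have hδ0 : 0 < δ := by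
      refine ENNReal.mul_pos (pow_ne_zero _ (by simp)) ?_
      simp [min_eq_iff, hε]
    have hf : ∀ᶠ p : LocLip X B × X in 𝓝 (h, x), edist p.1 h < δ :=
      (continuous_fst.tendsto (h, x)).eventually
        (Filter.eventually_of_mem (Metric.eball_mem_nhds h hδ0) fun f hf => hf)
    have hU : ∀ᶠ p : LocLip X B × X in 𝓝 (h, x), p.2.1 ∈ B.set n :=
      (continuous_subtype_val.comp continuous_snd).continuousAt.eventually (hopen.mem_nhds hx)
    filter_upwards [hf, hU] with p hp hpU
    have h2 := (min_lipENorm_le_edist n p.1 h).trans_lt hp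
    rw [hδ] at h2
    have h3 : min 1 (lipENorm (B.set n) (fun x : X => p.1 x - h x)) < min 1 (ENNReal.ofReal ε) :=
      lt_of_mul_lt_mul_left' h2
    have h4 : lipENorm (B.set n) (fun x : X => p.1 x - h x) < ENNReal.ofReal ε := by
      rcases min_lt_iff.1 h3 with h5 | h5
      · exact absurd (h5.trans_le (min_le_left _ _)) (lt_irrefl _)
      · exact h5.trans_le (min_le_right _ _)
    have h6 := (ofReal_abs_le_lipENorm (fun x : X => p.1 x - h x) hpU).trans_lt h4
    rw [Real.dist_eq, sub_zero]
    exact (ENNReal.ofReal_lt_ofReal_iff hε).1 h6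
  have h2 : Filter.Tendsto (fun p : LocLip X B × X => h p.2) (𝓝 (h, x)) (𝓝 (h x)) :=
    (LocallyLipschitz.continuous h.2).continuousAt.tendsto.comp
      continuous_snd.continuousAt.tendsto
  have h3 := h1.add h2
  simp only [sub_add_cancel, zero_add] at h3
  exact h3

variable {ι : Type*} [Fintype ι]

/-- The linear combination `combo g α` as an observable. -/
noncomputable def ofCombo (B : BoundedBasis N) {g : ι → X → ℝ} (hg : ∀ j, LocallyLipschitz (g j))
    (α : ι → ℝ) : LocLip X B := ⟨combo g α, locallyLipschitz_combo hg α⟩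

theorem lipENorm_combo_le (U : Set (EuclideanSpace ℝ (Fin N))) (g : ι → X → ℝ) (α : ι → ℝ) :
    lipENorm U (combo g α) ≤ ∑ j, ENNReal.ofReal |α j| * lipENorm U (g j) := by
  classical
  have : ∀ s : Finset ι, lipENorm U (fun x => ∑ j ∈ s, α j * g j x) ≤
      ∑ j ∈ s, ENNReal.ofReal |α j| * lipENorm U (g j) := by
    intro s
    induction s using Finset.induction_on with
    | empty => exact le_of_eq_of_le (lipENorm_zero (X := X) U) (by simp)
    | insert j s hj ih =>
      simp only [Finset.sum_insert hj]
      exact (lipENorm_add_le U (fun x => α j * g j x) _).trans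
        (add_le_add (lipENorm_smul_le U _ _) ih)
  exact this Finset.univ

/-- Each summand of the metric tends to `0` because the norms of the `g j` are finite. The weights
`2^{-(n+1)}` dominate the series, so dominated convergence for the counting measure passes to the
sum. -/
theorem continuous_ofCombo {g : ι → X → ℝ} (hg : ∀ j, LocallyLipschitz (g j))
    (hfin : ∀ n j, lipENorm (B.set n) (g j) ≠ ∞) : Continuous (ofCombo B hg) := by
  rw [continuous_iff_continuousAt]
  intro α
  rw [ContinuousAt, tendsto_iff_edist_tendsto_0]
  have hle : ∀ β n, lipENorm (B.set n) (fun x : X => ofCombo B hg β x - ofCombo B hg α x) ≤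
      ∑ j, ENNReal.ofReal |(β - α) j| * lipENorm (B.set n) (g j) := fun β n => by
    have : (fun x : X => ofCombo B hg β x - ofCombo B hg α x) = combo g (β - α) := by
      ext x
      simp [ofCombo, combo, sub_mul]
    rw [this]
    exact lipENorm_combo_le _ _ _
  have hterm : ∀ n, Filter.Tendsto (fun β => (2⁻¹ : ℝ≥0∞) ^ (n + 1) *
      min 1 (lipENorm (B.set n) (fun x : X => ofCombo B hg β x - ofCombo B hg α x)))
      (𝓝 α) (𝓝 0) := fun n => by
    have h1 : Filter.Tendsto (fun β : ι → ℝ =>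
        ∑ j, ENNReal.ofReal |(β - α) j| * lipENorm (B.set n) (g j)) (𝓝 α) (𝓝 0) := by
      have : Filter.Tendsto (fun β : ι → ℝ =>
          ∑ j, ENNReal.ofReal |(β - α) j| * lipENorm (B.set n) (g j)) (𝓝 α)
          (𝓝 (∑ j, ENNReal.ofReal |(α - α) j| * lipENorm (B.set n) (g j))) := by
        refine tendsto_finsetSum _ fun j _ => ENNReal.Tendsto.mul_const ?_ (Or.inr (hfin n j))
        refine ENNReal.tendsto_ofReal (Continuous.tendsto ?_ α)
        fun_prop
      simpa using this
    refine tendsto_of_tendsto_of_tendsto_of_le_of_le tendsto_const_nhds h1 (fun _ => zero_le)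
      fun β => ?_
    calc _ ≤ 1 * lipENorm (B.set n) (fun x : X => ofCombo B hg β x - ofCombo B hg α x) :=
          mul_le_mul' (pow_le_one₀ zero_le (by simp)) (min_le_right _ _)
      _ ≤ _ := by rw [one_mul]; exact hle β n
  have hsum : ∑' n : ℕ, (2⁻¹ : ℝ≥0∞) ^ (n + 1) ≠ ∞ := by
    rw [ENNReal.tsum_geometric_add_one, ENNReal.one_sub_inv_two, inv_inv,
      ENNReal.inv_mul_cancel (by simp) (by simp)]
    exact ENNReal.one_ne_top
  have hlim := tendsto_lintegral_filter_of_dominated_convergence (μ := Measure.count)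
    (l := 𝓝 α) (f := fun _ => 0)
    (F := fun β (n : ℕ) => (2⁻¹ : ℝ≥0∞) ^ (n + 1) *
      min 1 (lipENorm (B.set n) (fun x : X => ofCombo B hg β x - ofCombo B hg α x)))
    (fun n => (2⁻¹ : ℝ≥0∞) ^ (n + 1))
    (Filter.Eventually.of_forall fun _ => measurable_from_top)
    (Filter.Eventually.of_forall fun _ => Filter.Eventually.of_forall fun n =>
      mul_le_of_le_one_right' (min_le_left _ _))
    (by rwa [lintegral_count]) (Filter.Eventually.of_forall hterm)
  simp only [lintegral_count, tsum_zero] at hlim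
  exact hlim

/-! ### Measurability of sets of observables -/

variable {T : X → X} {k : ℕ}

theorem continuous_delayMap (hT : Continuous T) :
    Continuous fun p : LocLip X B × X => delayMap T p.1 k p.2 :=
  continuous_pi fun i =>
    continuous_eval.comp (continuous_fst.prodMk ((hT.iterate i).comp continuous_snd))

/-- The measure of the coincidence set is upper semicontinuous in `h`: by outer regularity it lies
in an open `U` of nearly the same measure, and the observables whose coincidence set leaves `U` form
a closed set, as a projection along compact sets. -/
theorem measurableSet_measure_coincidence (μ : Measure X) [IsFiniteMeasure μ] (hT : Continuous T)
    {K : Set X} (hK : IsCompact K) {C : Set (X × X)} (hC : IsClosed C) :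
    MeasurableSet {h : LocLip X B | μ {x | x ∈ K ∧ ∃ y ∈ K, (x, y) ∈ C ∧
      delayMap T h k x = delayMap T h k y} = 0} := by
  set G : LocLip X B → Set X := fun h => {x | x ∈ K ∧ ∃ y ∈ K, (x, y) ∈ C ∧
      delayMap T h k x = delayMap T h k y} with hG
  have hdm := continuous_delayMap (B := B) (k := k) hT
  have hcl : IsClosed {p : (LocLip X B × X) × X | (p.1.2, p.2) ∈ C ∧
      delayMap T p.1.1 k p.1.2 = delayMap T p.1.1 k p.2} :=
    (hC.preimage (by fun_prop)).inter (isClosed_eq (hdm.comp continuous_fst)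
      (hdm.comp ((continuous_fst.comp continuous_fst).prodMk continuous_snd)))
  have hcl' := isClosed_exists_mem_of_isCompact hK hcl
  have hopen : ∀ ε : ℝ≥0∞, IsOpen {h | μ (G h) < ε} := by
    intro ε
    rw [isOpen_iff_mem_nhds]
    intro h hh
    obtain ⟨U, hGU, hU, hUε⟩ := Set.exists_isOpen_lt_of_lt (μ := μ) (G h) ε hh
    have hU' := isClosed_exists_mem_of_isCompact hK
      (hcl'.inter (hU.isClosed_compl.preimage (continuous_snd (X := LocLip X B))))
    refine Filter.mem_of_superset (hU'.isOpen_compl.mem_nhds ?_) fun f hf => ?_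
    · rintro ⟨x, hx, hx', hxU⟩
      exact hxU (hGU ⟨hx, hx'⟩)
    · refine (measure_mono fun x hx => ?_).trans_lt hUε
      by_contra hxU
      exact hf ⟨x, hx.1, hx.2, hxU⟩
  have : {h : LocLip X B | μ (G h) = 0} = ⋂ n : ℕ, {h | μ (G h) < (n : ℝ≥0∞)⁻¹} := by
    ext h
    simp only [mem_ofPred_eq, mem_iInter]
    constructor
    · intro h0 n
      rw [h0]
      simp
    · intro hn
      by_contra h0
      obtain ⟨n, hn'⟩ := ENNReal.exists_inv_nat_lt h0
      exact lt_asymm hn' (hn n)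
  change MeasurableSet {h : LocLip X B | μ (G h) = 0}
  rw [this]
  exact MeasurableSet.iInter fun n => (hopen _).measurableSet

end LocLip

end LocLipTopology

/-! ### Propagation of coincidences for typical observables -/

section Propagation

variable {N : ℕ} {X : Set (EuclideanSpace ℝ (Fin N))} {B : BoundedBasis N}
  {ι : Type*} [Fintype ι] {T : X → X} {g : ι → X → ℝ}

/-- A coincidence of the delay vector of `x` with that of a point of `A` propagates to the whole
forward orbits. -/
def CoincidencePropagates {α : Type*} (T : α → α) (h : α → ℝ) (A : Set α) (k : ℕ) (x : α) :
    Prop :=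
  ∀ y ∈ A, delayMap T h k x = delayMap T h k y → ∀ n, h (T^[n] x) = h (T^[n] y)

theorem CoincidencePropagates.mono {α : Type*} {T : α → α} {h : α → ℝ} {A : Set α} {k l : ℕ}
    {x : α} (hkl : k ≤ l) (hx : CoincidencePropagates T h A k x) :
    CoincidencePropagates T h A l x :=
  fun y hy hxy => hx y hy (funext fun i => congrFun hxy (Fin.castLE hkl i))

theorem delayMap_apply_eq {α : Type*} {T : α → α} {h : α → ℝ} {x y : α}
    (hxy : ∀ n, h (T^[n] x) = h (T^[n] y)) (k : ℕ) :
    delayMap T h k (T x) = delayMap T h k (T y) :=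
  funext fun i => by
    simpa only [delayMap, ← Function.iterate_succ_apply] using hxy (i + 1)

/-- Only pairs with independent delay differences can violate propagation. These are covered by
countably many closed pieces, on each of which a single choice of directions `a` has invertible
delay matrix and the almost sure estimate applies. -/
theorem exists_measurableSet_coincidencePropagates (μ : Measure X) [IsFiniteMeasure μ]
    (hT : LocallyLipschitz T) (hg : ∀ j, LocallyLipschitz (g j)) {k n : ℕ} (hkn : 2 * k ≤ n)
    (hgn : Interpolates n g) {A : Set X} (hA : IsSigmaCompact A) (hdim : dimH A < k) :
    ∃ S : Set (LocLip X B), MeasurableSet S ∧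
      (∀ h ∈ S, ∀ᵐ x ∂μ, x ∈ A → CoincidencePropagates T h A k x) ∧
      ∀ v : LocLip X B, ∀ᵐ α : ι → ℝ, v + LocLip.ofCombo B hg α ∈ S := by
  obtain ⟨K', hK', rfl⟩ := hA
  -- An increasing exhaustion, so that `x` and `y` lie in a common compact set.
  set K := accumulate K'
  have hK : ∀ m, IsCompact (K m) := isCompact_accumulate hK'
  have hKmono : Monotone K := monotone_accumulate
  have hKU : ⋃ m, K m = ⋃ m, K' m := iUnion_accumulate
  have hdimK : ∀ m, dimH (K m) < k := fun m =>
    (dimH_mono ((subset_iUnion K m).trans hKU.subset)).trans_lt hdim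
  have hTi : ∀ i, Continuous T^[i] := fun i => hT.continuous.iterate i
  have hcg : ∀ a, Continuous (combo g a) := fun a => (locallyLipschitz_combo hg a).continuous
  have hO : ∀ a : Fin k → ι → ℝ, IsOpen {p : X × X | (delayMatrix T g a p.1 p.2).det ≠ 0} :=
    fun a => by
      refine isOpen_ne_fun (Continuous.matrix_det ?_) continuous_const
      refine continuous_matrix fun l i => ?_
      simp only [delayMatrix, Matrix.of_apply]
      exact ((hcg _).comp ((hTi _).comp continuous_fst)).sub
        ((hcg _).comp ((hTi _).comp continuous_snd))
  -- Lindelöf leaves countably many `a`; each open set is then exhausted by closed sets, as the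
  -- projection arguments need closedness.
  obtain ⟨s, hs, hsU⟩ := TopologicalSpace.isOpen_iUnion_countable _ hO
  choose F hF hFO hFU _ using fun a => (hO a).exists_iUnion_isClosed
  set S : (Fin k → ι → ℝ) → ℕ → ℕ → Set (LocLip X B) := fun a m n =>
    {h | μ {x | x ∈ K m ∧ ∃ y ∈ K m, (x, y) ∈ F a n ∧ delayMap T h k x = delayMap T h k y} = 0}
  refine ⟨⋂ a ∈ s, ⋂ m, ⋂ n, S a m n, ?_, ?_, ?_⟩
  · exact MeasurableSet.biInter hs fun a _ => MeasurableSet.iInter fun m =>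
      MeasurableSet.iInter fun n =>
        LocLip.measurableSet_measure_coincidence μ hT.continuous (hK m) (hF a n)
  · intro h hh
    simp only [mem_iInter] at hh
    have h1 : ∀ᵐ x ∂μ, ∀ a ∈ s, ∀ m n, ¬ (x ∈ K m ∧ ∃ y ∈ K m, (x, y) ∈ F a n ∧
        delayMap T h k x = delayMap T h k y) := by
      rw [ae_ball_iff hs]
      intro a ha
      rw [ae_all_iff]
      intro m
      rw [ae_all_iff]
      intro n
      rw [ae_iff]
      simp only [not_not]
      exact hh a ha m n
    filter_upwards [h1] with x hx hxA y hyA hxy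
    refine eq_of_not_linearIndependent T h (fun hli => ?_) hxy
    obtain ⟨a, ha⟩ := exists_det_delayMatrix_ne_zero T hkn hgn hli
    have hmem : (x, y) ∈ ⋃ a ∈ s, {p : X × X | (delayMatrix T g a p.1 p.2).det ≠ 0} := by
      rw [hsU]
      exact mem_iUnion.2 ⟨a, ha⟩
    obtain ⟨b, hb, hxyb⟩ := mem_iUnion₂.1 hmem
    rw [← hFU b] at hxyb
    obtain ⟨n, hn⟩ := mem_iUnion.1 hxyb
    rw [← hKU] at hxA hyA
    obtain ⟨i, hi⟩ := mem_iUnion.1 hxA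
    obtain ⟨j, hj⟩ := mem_iUnion.1 hyA
    exact hx b hb (max i j) n
      ⟨hKmono (le_max_left i j) hi, y, hKmono (le_max_right i j) hj, hn, hxy⟩
  · intro v
    simp only [mem_iInter]
    rw [ae_ball_iff hs]
    intro a _
    rw [ae_all_iff]
    intro m
    rw [ae_all_iff]
    intro n
    filter_upwards [ae_measure_coincidence_eq_zero μ hT hg (hK m) (hdimK m) a (hF a n)
      (fun p hp => hFO a n hp) v.2] with α hα
    exact measure_mono_null (fun x hx => hx.2) hα

end Propagation

/-! ### Full-measure sets and prediction maps -/

section Prediction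

/-- Inner regularity is applied in the complete space `E`, since `X` is merely Borel; compact
subsets of `E` contained in `X` remain compact in `X`. -/
theorem exists_isSigmaCompact_subset {E : Type*} [MetricSpace E] [CompleteSpace E]
    [SecondCountableTopology E] [MeasurableSpace E] [BorelSpace E] {X : Set E}
    (hX : MeasurableSet X) (μ : Measure X) [IsFiniteMeasure μ] {A : Set X} (hA : μ Aᶜ = 0) :
    ∃ F ⊆ A, IsSigmaCompact F ∧ μ Fᶜ = 0 := by
  obtain ⟨D, hAD, hD, hD0⟩ := exists_measurable_superset_of_null hA
  have he := MeasurableEmbedding.subtype_coe hX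
  have hD' : MeasurableSet (Subtype.val '' Dᶜ) := he.measurableSet_image.2 hD.compl
  choose K hK hKc hKlt using fun n : ℕ => hD'.exists_isCompact_sdiff_lt
    (μ := μ.map Subtype.val) (measure_ne_top _ _) (ε := (n : ℝ≥0∞)⁻¹) (by simp)
  have hKD : ∀ n, Subtype.val ⁻¹' K n ⊆ Dᶜ := fun n x hx => by
    obtain ⟨y, hy, hyx⟩ := hK n hx
    rwa [← Subtype.val_injective hyx]
  refine ⟨⋃ n, Subtype.val ⁻¹' K n, iUnion_subset fun n => (hKD n).trans
    (compl_subset_comm.1 hAD), isSigmaCompact_iUnion_of_isCompact _ fun n => ?_, ?_⟩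
  · refine (Topology.IsInducing.subtypeVal.isCompact_preimage_iff ?_).2 (hKc n)
    exact (hK n).trans (image_subset_range _ _)
  · have hsub : ∀ n : ℕ, μ (⋃ n, Subtype.val ⁻¹' K n)ᶜ ≤ (n : ℝ≥0∞)⁻¹ := fun n => by
      have h1 : (⋃ n, Subtype.val ⁻¹' K n)ᶜ ⊆ D ∪ Subtype.val ⁻¹' (Subtype.val '' Dᶜ \ K n) := by
        intro x hx
        by_cases hxD : x ∈ D
        · exact Or.inl hxD
        · exact Or.inr ⟨⟨x, hxD, rfl⟩, fun hxK => hx (mem_iUnion.2 ⟨n, hxK⟩)⟩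
      refine (measure_mono h1).trans ((measure_union_le _ _).trans ?_)
      rw [hD0, zero_add, ← he.map_apply]
      exact (hKlt n).le
    by_contra h0
    obtain ⟨n, hn⟩ := ENNReal.exists_inv_nat_lt h0
    exact (hn.trans_le (hsub n)).false

/-- A full-measure set contains a `σ`-compact set of full measure, which may be taken forward
invariant if the measure is invariant. -/
theorem exists_isSigmaCompact_mapsTo {E : Type*} [MetricSpace E] [CompleteSpace E]
    [SecondCountableTopology E] [MeasurableSpace E] [BorelSpace E] {X : Set E}
    (hX : MeasurableSet X) (μ : Measure X) [IsFiniteMeasure μ] {T : X → X} (hT : Continuous T)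
    {A : Set X} (hA : μ Aᶜ = 0) :
    ∃ F ⊆ A, IsSigmaCompact F ∧ μ Fᶜ = 0 ∧ (MeasurePreserving T μ μ → MapsTo T F F) := by
  by_cases hμ : MeasurePreserving T μ μ
  swap
  · obtain ⟨F, hFA, hF, hF0⟩ := exists_isSigmaCompact_subset hX μ hA
    exact ⟨F, hFA, hF, hF0, fun h => absurd h hμ⟩
  -- Passing first to points whose whole orbit stays in `A` allows closing up under forward images,
  -- which preserve σ-compactness.
  have h0 : μ (⋂ n, T^[n] ⁻¹' A)ᶜ = 0 := by
    rw [compl_iInter, measure_iUnion_null_iff]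
    exact fun n => (hμ.iterate n).quasiMeasurePreserving.preimage_null hA
  obtain ⟨F, hFA, hF, hF0⟩ := exists_isSigmaCompact_subset hX μ h0
  refine ⟨⋃ n, T^[n] '' F, iUnion_subset fun n => ?_,
    isSigmaCompact_iUnion _ fun n => hF.image (hT.iterate n), ?_, fun _ => ?_⟩
  · rintro _ ⟨x, hx, rfl⟩
    exact mem_iInter.1 (hFA hx) n
  · refine measure_mono_null (compl_subset_compl.2 ?_) hF0
    exact fun x hx => mem_iUnion.2 ⟨0, x, hx, rfl⟩
  · intro x hx
    obtain ⟨n, z, hz, rfl⟩ := mem_iUnion.1 hx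
    exact mem_iUnion.2 ⟨n + 1, z, hz, Function.iterate_succ_apply' T n z⟩

theorem IsSigmaCompact.measurableSet_of_t2 {Y : Type*} [TopologicalSpace Y] [T2Space Y]
    [MeasurableSpace Y] [OpensMeasurableSpace Y] {s : Set Y} (hs : IsSigmaCompact s) :
    MeasurableSet s := by
  obtain ⟨K, hK, rfl⟩ := hs
  exact MeasurableSet.iUnion fun n => (hK n).measurableSet

variable {X : Type*} [TopologicalSpace X] {T : X → X} {h : X → ℝ} {k : ℕ} {F : Set X}
  {S : delayMap T h k '' F → Fin k → ℝ}

/-- The preimage of a closed set is the trace on `φ(F)` of the continuous image of a σ-compact set.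
-/
theorem measurable_of_isPredictionMap (hT : Continuous T) (hh : Continuous h)
    (hF : IsSigmaCompact F) (hS : IsPredictionMap T h k F S) : Measurable S := by
  have hφ : Continuous (delayMap T h k) := continuous_pi fun i => hh.comp (hT.iterate i)
  refine measurable_of_isClosed fun C hC => ?_
  have hCF : IsSigmaCompact (F ∩ (fun x => delayMap T h k (T x)) ⁻¹' C) := by
    obtain ⟨K, hK, rfl⟩ := hF
    rw [iUnion_inter]
    exact isSigmaCompact_iUnion_of_isCompact _ fun n => (hK n).inter_right
      (hC.preimage (hφ.comp hT))
  have : S ⁻¹' C = Subtype.val ⁻¹' (delayMap T h k ''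
      (F ∩ (fun x => delayMap T h k (T x)) ⁻¹' C)) := by
    ext ⟨y, x, hx, rfl⟩
    rw [mem_preimage, hS x hx]
    constructor
    · exact fun hxC => ⟨x, ⟨hx, hxC⟩, rfl⟩
    · rintro ⟨z, ⟨hz, hzC⟩, hzx⟩
      have h1 := hS x hx
      have h2 := hS z hz
      have h3 : S ⟨delayMap T h k x, mem_image_of_mem _ hx⟩ =
        S ⟨delayMap T h k z, mem_image_of_mem _ hz⟩ := congrArg S (Subtype.ext hzx.symm)
      rw [← h1, h3, h2]
      exact hzC
  rw [this]
  exact measurable_subtype_coe ((hCF.image hφ).measurableSet_of_t2)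

/-- The preimage of a closed `C` is the trace on `φ(F)` of the image of a compact part of `A`, hence
closed. This image also involves points of `A` outside `F`, so propagation is required against all
of `A`. -/
theorem continuous_of_isPredictionMap (hT : Continuous T) (hh : Continuous h) {A : Set X}
    (hA : IsCompact A) (hFA : F ⊆ A) (hprop : ∀ x ∈ F, CoincidencePropagates T h A k x)
    (hS : IsPredictionMap T h k F S) : Continuous S := by
  have hφ : Continuous (delayMap T h k) := continuous_pi fun i => hh.comp (hT.iterate i)
  refine continuous_iff_isClosed.2 fun C hC => ?_
  have hCA : IsCompact (A ∩ (fun x => delayMap T h k (T x)) ⁻¹' C) :=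
    hA.inter_right (hC.preimage (hφ.comp hT))
  have : S ⁻¹' C = Subtype.val ⁻¹' (delayMap T h k ''
      (A ∩ (fun x => delayMap T h k (T x)) ⁻¹' C)) := by
    ext ⟨y, x, hx, rfl⟩
    rw [mem_preimage, hS x hx]
    constructor
    · exact fun hxC => ⟨x, ⟨hFA hx, hxC⟩, rfl⟩
    · rintro ⟨z, ⟨hz, hzC⟩, hzx⟩
      rw [delayMap_apply_eq (hprop x hx z hz hzx.symm) k]
      exact hzC
  rw [this]
  exact (hCA.image hφ).isClosed.preimage continuous_subtype_val

end Prediction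

/-! ### Critical delay lengths, the probe measure and the final assembly -/

/-- A finite dimension is exceeded exactly by the natural numbers from some point on. -/
theorem exists_nat_forall_lt_iff {d : ℝ≥0∞} (hd : d ≠ ∞) : ∃ m : ℕ, ∀ k : ℕ, d < k ↔ m ≤ k := by
  classical
  have hex : ∃ k : ℕ, d < k := ENNReal.exists_nat_gt hd
  exact ⟨Nat.find hex, fun k => ⟨fun hk => Nat.find_min' hex hk, fun hk =>
    (Nat.find_spec hex).trans_le (by exact_mod_cast hk)⟩⟩

theorem dimH_ne_top_of_finrank {N : ℕ} (A : Set (EuclideanSpace ℝ (Fin N))) : dimH A ≠ ∞ := by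
  refine ne_top_of_le_ne_top ?_ (dimH_mono (subset_univ A))
  rw [Real.dimH_univ_eq_finrank]
  exact ENNReal.natCast_ne_top _

theorem theorem1p16 {N : ℕ} (B : BoundedBasis N) (X : Set (EuclideanSpace ℝ (Fin N)))
    (hX : MeasurableSet X) (μ : Measure X) [IsProbabilityMeasure μ]
    (T : X → X) (hT : LocallyLipschitz T) :
    IsPrevalent {h : LocLip X B |
      ∀ k : ℕ, measureDimH (μ.map Subtype.val) < (k : ℝ≥0∞) →
        IsASDetPredictable μ T h k ∧
        ∃ Xh : Set X, MeasurableSet Xh ∧ μ Xhᶜ = 0 ∧ MeasurableSet (delayMap T h k '' Xh) ∧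
          ∃ S : delayMap T h k '' Xh → (Fin k → ℝ),
            Measurable S ∧ IsPredictionMap T h k Xh S ∧
            (MeasurePreserving T μ μ →
              MapsTo T Xh Xh ∧ ∀ y, S y ∈ delayMap T h k '' Xh) ∧
            (IsCompact X → dimH (Subtype.val '' μ.support) < (k : ℝ≥0∞) → Continuous S)} := by
  classical
  have hdimval : ∀ A : Set X, dimH (Subtype.val '' A) = dimH A := fun A =>
    isometry_subtype_coe.dimH_image A
  -- It suffices to treat the least admissible delay length: propagation for `k₀` implies
  -- propagation for every larger `k`.
  obtain ⟨k₀, hk₀⟩ := exists_nat_forall_lt_iff (d := measureDimH (μ.map Subtype.val)) (by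
    refine ne_top_of_le_ne_top (dimH_ne_top_of_finrank (N := N) univ) ?_
    exact iInf₂_le_of_le univ MeasurableSet.univ (iInf_le _ (by simp)))
  obtain ⟨A₀, hA₀, hA₀0, hA₀d⟩ : ∃ A : Set X, IsSigmaCompact A ∧ μ Aᶜ = 0 ∧ dimH A < k₀ := by
    have h1 := (hk₀ k₀).2 le_rfl
    simp only [measureDimH, iInf_lt_iff] at h1
    obtain ⟨D, hD, hD0, hDk⟩ := h1
    rw [(MeasurableEmbedding.subtype_coe hX).map_apply] at hD0
    obtain ⟨F, hFD, hF, hF0⟩ := exists_isSigmaCompact_subset hX μ (A := Subtype.val ⁻¹' D) hD0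
    refine ⟨F, hF, hF0, ?_⟩
    rw [← hdimval]
    exact (dimH_mono (image_subset_iff.2 hFD)).trans_lt hDk
  set A₁ : Set X := if IsCompact X then μ.support else ∅ with hA₁
  have hA₁c : IsCompact A₁ := by
    rw [hA₁]
    split_ifs with hXc
    · have := isCompact_iff_compactSpace.1 hXc
      exact Measure.isClosed_support.isCompact
    · exact isCompact_empty
  obtain ⟨k₁, hk₁⟩ := exists_nat_forall_lt_iff (dimH_ne_top_of_finrank (Subtype.val '' A₁))
  have hA₁d : dimH A₁ < k₁ := by
    rw [← hdimval]
    exact (hk₁ k₁).2 le_rfl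
  -- Two orbit segments of the critical length must be interpolated; one polynomial family then
  -- serves both `A₀` and `A₁`.
  set n := 2 * max k₀ k₁ with hn
  set g : (Fin n → Option (Option (Fin N))) → X → ℝ := fun j x => quadricProd n j x with hg_def
  have hg : ∀ j, LocallyLipschitz (g j) := fun j =>
    (contDiff_quadricProd n j).locallyLipschitz.comp isometry_subtype_coe.lipschitz.locallyLipschitz
  have hgn : Interpolates n g := (interpolates_quadricProd N n).restrict X
  have hgfin : ∀ m j, lipENorm (B.set m) (g j) ≠ ∞ := fun m j =>
    lipENorm_ne_top (B.isBounded m) (contDiff_quadricProd n j)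
  obtain ⟨S₀, hS₀m, hS₀, hS₀v⟩ := exists_measurableSet_coincidencePropagates (B := B) μ hT hg
    (Nat.mul_le_mul_left 2 (le_max_left k₀ k₁)) hgn hA₀ hA₀d
  obtain ⟨S₁, hS₁m, hS₁, hS₁v⟩ := exists_measurableSet_coincidencePropagates (B := B) μ hT hg
    (Nat.mul_le_mul_left 2 (le_max_right k₀ k₁)) hgn hA₁c.isSigmaCompact hA₁d
  have hcont := LocLip.continuous_ofCombo (B := B) hg hgfin
  -- The probe is Lebesgue measure on the unit ball of coefficients, carried to observables; its
  -- image is compact by continuity of `ofCombo`.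
  refine ⟨S₀ ∩ S₁, ?_, hS₀m.inter hS₁m,
    (volume.restrict (Metric.closedBall 0 1)).map (LocLip.ofCombo B hg),
    ⟨LocLip.ofCombo B hg '' Metric.closedBall 0 1, (isCompact_closedBall _ _).image hcont,
      ?_, ?_⟩, ?_⟩
  · rintro h ⟨hh₀, hh₁⟩ k hk
    have hhc : Continuous h := LocallyLipschitz.continuous h.2
    have hk₀k : k₀ ≤ k := (hk₀ k).1 hk
    have hφ : Continuous (delayMap T h k) :=
      continuous_pi fun i => hhc.comp (hT.continuous.iterate i)
    have hae : ∀ᵐ x ∂μ, x ∈ A₀ ∧ CoincidencePropagates T h A₀ k x ∧ (IsCompact X →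
        dimH (Subtype.val '' μ.support) < k →
          x ∈ μ.support ∧ CoincidencePropagates T h μ.support k x) := by
      have hsupp : ∀ᵐ x ∂μ, x ∈ μ.support := Measure.support_mem_ae
      have h0 : ∀ᵐ x ∂μ, x ∈ A₀ := hA₀0
      filter_upwards [h0, hS₀ h hh₀, hS₁ h hh₁, hsupp] with x hx h₀ h₁ hxs
      refine ⟨hx, (h₀ hx).mono hk₀k, fun hXc hd => ⟨hxs, ?_⟩⟩
      have hA₁' : A₁ = μ.support := if_pos hXc
      rw [hA₁'] at h₁ hk₁
      exact (h₁ hxs).mono ((hk₁ k).1 hd)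
    obtain ⟨F, hFA, hF, hF0, hFT⟩ := exists_isSigmaCompact_mapsTo hX μ hT.continuous
      (A := {x | x ∈ A₀ ∧ CoincidencePropagates T h A₀ k x ∧ (IsCompact X →
        dimH (Subtype.val '' μ.support) < k →
          x ∈ μ.support ∧ CoincidencePropagates T h μ.support k x)}) hae
    have hpred : ∀ x₁ ∈ F, ∀ x₂ ∈ F, delayMap T h k x₁ = delayMap T h k x₂ →
        delayMap T h k (T x₁) = delayMap T h k (T x₂) := fun x₁ h₁ x₂ h₂ h₁₂ =>
      delayMap_apply_eq ((hFA h₁).2.1 x₂ (hFA h₂).1 h₁₂) k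
    refine ⟨⟨F, hF.measurableSet_of_t2, hF0, hpred⟩, F, hF.measurableSet_of_t2, hF0,
      (hF.image hφ).measurableSet_of_t2, ?_⟩
    -- `S` applies `φ ∘ T` to a chosen preimage in `F`; predictability makes the value independent
    -- of the choice.
    have hS : IsPredictionMap T h k F fun y => delayMap T h k (T y.2.choose) := fun x hx => by
      have hy := (mem_image_of_mem (delayMap T h k) hx : _ ∈ delayMap T h k '' F).choose_spec
      exact hpred _ hy.1 _ hx hy.2
    refine ⟨_, measurable_of_isPredictionMap hT.continuous hhc hF hS, hS, fun hμ => ?_,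
      fun hXc hd => ?_⟩
    · exact ⟨hFT hμ, fun y => mem_image_of_mem _ (hFT hμ y.2.choose_spec.1)⟩
    · have := isCompact_iff_compactSpace.1 hXc
      exact continuous_of_isPredictionMap hT.continuous hhc
        (Measure.isClosed_support (μ := μ)).isCompact
        (fun x hx => ((hFA hx).2.2 hXc hd).1) (fun x hx => ((hFA hx).2.2 hXc hd).2) hS
  · rw [Measure.map_apply hcont.measurable
      ((isCompact_closedBall _ _).image hcont).isClosed.measurableSet]
    refine lt_of_lt_of_le ?_ (measure_mono (subset_preimage_image _ _))
    rw [Measure.restrict_apply_self]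
    exact Metric.measure_closedBall_pos _ _ one_pos
  · refine (measure_mono (subset_univ _)).trans_lt ?_
    rw [Measure.map_apply hcont.measurable MeasurableSet.univ, preimage_univ,
      Measure.restrict_apply_univ]
    exact measure_closedBall_lt_top
  · intro v
    refine (ae_map_iff hcont.measurable.aemeasurable ?_).2 (ae_restrict_of_ae ?_)
    · have hadd : Continuous fun e : LocLip X B => v + e := by
        refine Isometry.continuous fun e f => ?_
        simp only [LocLip.edist_eq, LocLip.edistFun, LocLip.coe_add, add_sub_add_left_eq_sub]
      exact (hS₀m.inter hS₁m).preimage hadd.measurable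
    · filter_upwards [hS₀v v, hS₁v v] with α h₀ h₁
      exact ⟨h₀, h₁⟩
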